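/- Let $\mathcal P$ be a set of processes and $\mathcal V$ a set of messages. Events are sends $P\triangleright Q!m$ (performed by $P$) and receptions $Q\triangleleft P?m$ (performed by $Q$); $\Sigma$ is the set of events and $\Sigma^\infty=\Sigma^*\cup\Sigma^\omega$. **Global types.** Global types are the terms $G ::= 0 \mid \sum_{i\in I} P\to Q_i:m_i.G_i \mid \mu t.G \mid t$ ($I$ finite and non-empty) such that the branches of each choice are distinguishable ($i\ne j$ implies $Q_i\neq Q_j$ or $m_i\ne m_j$), recursion is guarded (there is a message between $\mu t$ and $t$), all variables are bound, and different binders bind different variables. The language $\mathcal L(G)\subseteq\Sigma^\infty$ is the set of traces of the maximal runs (infinite, or ending in a final state) of the following automaton. Its states are the subterms of $G$ and the pairs $(C,j)$ of a choice $C=\sum_{i\in I}P\to Q_i:m_i.G_i$ occurring in $G$ and $j\in I$. Its initial state is $G$ and its only final state is $0$. Its transitions are $C\xrightarrow{P\triangleright Q_j!m_j}(C,j)$, $(C,j)\xrightarrow{Q_j\triangleleft P?m_j}G_j$, $\mu t.G'\xrightarrow{\varepsilon}G'$ and $t\xrightarrow{\varepsilon}\mu t.G'$. **HMSCs.** A basic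 message sequence chart (BMSC) consists of finitely many send and receive event nodes, assigned to processes and labelled by events, with a total order on the nodes of each process and a bijection from send to receive nodes that is compatible with the labels and the FIFO order; the reflexive transitive closure of the process orders and the send-receive pairs is a partial order. Concatenation of a finite or infinite sequence of charts takes the disjoint union and puts, on each process, the nodes of earlier charts before those of later charts. The language of a chart is the set of label sequences of all linearisations of its set of nodes as a finite word, or as an infinite word indexed by $\mathbb N$. A high-level message sequence chart (HMSC) is a finite directed graph with an initial vertex, terminal vertices and a BMSC at each vertex, in which every vertex is reachable and every initial path can be completed to a maximal one (infinite, or ending in a terminal vertex). Its language $\mathcal L(H)$ is the union, over all maximal initial paths, of the languages of the concatenations of the BMSCs along the path. **Construction.** For a global type $G$, the HMSC $H(G)$ has as vertices the subterms of $G$ and the pairs $(C,j)$ as above. Its edges are $C\to (C,j)$, $(C,j)\to G_j$, $\mu t.G'\to G'$ and $t\to\mu t.G'$. Its initial vertex is $G$ and its only terminal vertex is $0$ (if $0$ occurs in $G$). The BMSC at $(C,j)$ is the single message exchange $P\to Q_j:m_j$, and all other vertices carry the empty BMSC. **Indistinguishability.** Let $\sim$ be the equivalence relation on $\Sigma^*$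 generated by swapping two adjacent events in $w\,e\,e'\,u$ in the following cases: (1) $e=P\triangleright Q!m$, $e'=R\triangleright S!m'$ and $P\ne R$; (2) $e=Q\triangleleft P?m$, $e'=S\triangleleft R?m'$ and $Q\neq S$; (3) $e=P\triangleright Q!m$, $e'=S\triangleleft R?m'$, $P\ne S$ and ($P\neq R$ or $Q\ne S$); (4) $e=P\triangleright Q!m$, $e'=Q\triangleleft P?m'$ and $w$ contains more sends from $P$ to $Q$ than receptions by $Q$ from $P$. For $u,v\in\Sigma^\omega$ let $u\preceq^\omega_\sim v$ if for every finite prefix $u'$ of $u$ there are a finite prefix $v'$ of $v$ and $x\in\Sigma^*$ with $u'x\sim v'$. For $L\subseteq\Sigma^\infty$ let $$\mathcal C^\sim(L)=\{w'\in\Sigma^*\mid \exists w\in L\cap\Sigma^*.\ w'\sim w\}\cup\{w'\in\Sigma^\omega\mid\exists w\in L\cap\Sigma^\omega.\ w'\preceq^\omega_\sim w\}.$$ **Theorem.** For every global type $G$, $\mathcal L(G)\subseteq\mathcal L(H(G))$ and $\mathcal C^\sim(\mathcal L(G))=\mathcal C^\sim(\mathcal L(H(G)))$. -/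

import Mathlib

namespace MST

/-! ### Events and finite or infinite words -/

/-- Events: `send p q m` is performed by `p` (sending `m` to `q`), and
`recv p q m` is performed by `q` (receiving `m` from `p`). -/
inductive Event (P V : Type*) where
  | send (p q : P) (m : V)
  | recv (p q : P) (m : V)

/-- `Σ^∞`: the finite and the infinite words over an alphabet. -/
inductive Word (A : Type*) where
  | fin (w : List A)
  | inf (w : ℕ → A)

/-- The prefix of length `n` of an infinite word. -/
def takeInf {A : Type*} (w : ℕ → A) (n : ℕ) : List A := (List.range n).map w

/-! ### The indistinguishability relation and the closure operator -/

open Classical in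
/-- The number of send events from `p` to `q` in `w`. -/
noncomputable def countSend {P V : Type*} (p q : P) (w : List (Event P V)) : ℕ :=
  w.countP fun e => decide (∃ m, e = Event.send p q m)

open Classical in
/-- The number of events in `w` where `q` receives from `p`. -/
noncomputable def countRecv {P V : Type*} (p q : P) (w : List (Event P V)) : ℕ :=
  w.countP fun e => decide (∃ m, e = Event.recv p q m)

/-- One swap of two adjacent events, according to the four rules. -/
inductive Swap {P V : Type*} : List (Event P V) → List (Event P V) → Prop where
  | send_send (w u : List (Event P V)) (p q r s : P) (m m' : V) (h : p ≠ r) :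
      Swap (w ++ .send p q m :: .send r s m' :: u) (w ++ .send r s m' :: .send p q m :: u)
  | recv_recv (w u : List (Event P V)) (p q r s : P) (m m' : V) (h : q ≠ s) :
      Swap (w ++ .recv p q m :: .recv r s m' :: u) (w ++ .recv r s m' :: .recv p q m :: u)
  | send_recv (w u : List (Event P V)) (p q r s : P) (m m' : V)
      (h : p ≠ s ∧ (p ≠ r ∨ q ≠ s)) :
      Swap (w ++ .send p q m :: .recv r s m' :: u) (w ++ .recv r s m' :: .send p q m :: u)
  | same_channel (w u : List (Event P V)) (p q : P) (m m' : V)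
      (h : countRecv p q w < countSend p q w) :
      Swap (w ++ .send p q m :: .recv p q m' :: u) (w ++ .recv p q m' :: .send p q m :: u)

/-- Indistinguishability `∼` of finite words: the equivalence relation generated by the swaps,
that is, `w ∼ u` if `u` is obtained from `w` by finitely many swaps, in either direction. -/
def Indist {P V : Type*} : List (Event P V) → List (Event P V) → Prop :=
  Relation.EqvGen Swap

/-- `u ⪯ v` for infinite words: every finite prefix of `u` can be extended to a finite word
that is indistinguishable from a finite prefix of `v`. -/
def InfPrec {P V : Type*} (u v : ℕ → Event P V) : Prop :=
  ∀ n, ∃ (k : ℕ) (x : List (Event P V)), Indist (takeInf u n ++ x) (takeInf v k)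

/-- The closure `C^∼(L)` of a language of finite and infinite words. -/
def closure {P V : Type*} (L : Set (Word (Event P V))) : Set (Word (Event P V)) :=
  {x | match x with
    | .fin w' => ∃ w, Word.fin w ∈ L ∧ Indist w' w
    | .inf w' => ∃ w, Word.inf w ∈ L ∧ InfPrec w' w}

/-! ### State machines with silent moves -/

/-- A finite state machine over `A`; the label `none` is the empty word `ε`. -/
structure StateMachine (A : Type*) where
  State : Type*
  finite_state : Finite State
  trans : State → Option A → State → Prop
  start : State
  final : Set State

/-- The finite or infinite word obtained from an infinite sequence of letters and `ε`s by
erasing the `ε`s. -/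
def IsTrace {A : Type*} (a : ℕ → Option A) : Word A → Prop
  | .fin w => ∃ n, (∀ i, n ≤ i → a i = none) ∧ w = (takeInf a n).reduceOption
  | .inf w => ∃ φ : ℕ → ℕ, StrictMono φ ∧ (∀ i, a (φ i) = some (w i)) ∧
      ∀ k, k ∉ Set.range φ → a k = none

/-- The traces of the maximal runs: finite runs ending in a final state and infinite runs. -/
def StateMachine.language {A : Type*} (M : StateMachine A) : Set (Word A) :=
  {x | (∃ (n : ℕ) (ρ : Fin (n + 1) → M.State) (a : Fin n → Option A),
          ρ 0 = M.start ∧ (∀ i : Fin n, M.trans (ρ i.castSucc) (a i) (ρ i.succ)) ∧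
          ρ (Fin.last n) ∈ M.final ∧ x = Word.fin (List.ofFn a).reduceOption) ∨
       (∃ (ρ : ℕ → M.State) (a : ℕ → Option A),
          ρ 0 = M.start ∧ (∀ i, M.trans (ρ i) (a i) (ρ (i + 1))) ∧ IsTrace a x)}

/-! ### Message sequence charts -/

/-- The data of a (prefix) message sequence chart. The event nodes are `Send ⊕ Recv`, `link` is
the partial function from send nodes to receive nodes, `procLe p` is the order on the nodes of
process `p`. -/
structure Chart (P V : Type*) where
  Send : Type
  Recv : Type
  proc : Send ⊕ Recv → P
  link : Send → Option Recv
  label : Send ⊕ Recv → Event P V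
  procLe : P → Send ⊕ Recv → Send ⊕ Recv → Prop

namespace Chart

variable {P V : Type*}

/-- The event nodes. -/
abbrev Node (M : Chart P V) : Type := M.Send ⊕ M.Recv

/-- The generating pairs of the induced order: process orders and send-receive pairs. -/
inductive Step (M : Chart P V) : M.Node → M.Node → Prop where
  | proc (p : P) (e e' : M.Node) (h : M.procLe p e e') : Step M e e'
  | link (s : M.Send) (r : M.Recv) (h : M.link s = some r) : Step M (.inl s) (.inr r)

/-- The induced order `≤_M`. -/
def le (M : Chart P V) : M.Node → M.Node → Prop := Relation.ReflTransGen M.Step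

/-- `M` respects FIFO order: on every channel, once a send is unmatched all later ones are, and
matched sends are received in the order in which they are sent (so neither messages of the same
content nor messages of different contents overtake each other). -/
def RespectsFIFO (M : Chart P V) : Prop :=
  ∀ (p q : P) (s₁ s₂ : M.Send) (m₁ m₂ : V),
    M.label (.inl s₁) = .send p q m₁ → M.label (.inl s₂) = .send p q m₂ →
    M.le (.inl s₁) (.inl s₂) →
      (M.link s₁ = none → M.link s₂ = none) ∧
      (∀ r₁ r₂, M.link s₁ = some r₁ → M.link s₂ = some r₂ → M.procLe q (.inr r₁) (.inr r₂))

/-- `M` is a prefix message sequence chart (respecting FIFO order). -/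
structure IsPrefixMSC (M : Chart P V) : Prop where
  link_injective : ∀ s s' r, M.link s = some r → M.link s' = some r → s = s'
  link_surjective : ∀ r, ∃ s, M.link s = some r
  procLe_proc : ∀ p e e', M.procLe p e e' → M.proc e = p ∧ M.proc e' = p
  procLe_refl : ∀ e, M.procLe (M.proc e) e e
  procLe_trans : ∀ p e e' e'', M.procLe p e e' → M.procLe p e' e'' → M.procLe p e e''
  procLe_total : ∀ p e e', M.proc e = p → M.proc e' = p → M.procLe p e e' ∨ M.procLe p e' e
  le_antisymm : ∀ e e', M.le e e' → M.le e' e → e = e'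
  label_link : ∀ s r, M.link s = some r → ∃ m,
    M.label (.inl s) = .send (M.proc (.inl s)) (M.proc (.inr r)) m ∧
    M.label (.inr r) = .recv (M.proc (.inl s)) (M.proc (.inr r)) m
  label_unmatched : ∀ s, M.link s = none → ∃ q m, q ≠ M.proc (.inl s) ∧
    M.label (.inl s) = .send (M.proc (.inl s)) q m
  fifo : M.RespectsFIFO

/-- A basic MSC: every send node is matched and there are finitely many nodes. -/
structure IsBMSC (M : Chart P V) : Prop extends M.IsPrefixMSC where
  link_total : ∀ s, M.link s ≠ none
  finite_node : Finite M.Node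

/-- The language of a chart: the label sequences of the linearisations of its set of nodes. -/
def language (M : Chart P V) : Set (Word (Event P V)) :=
  {x | match x with
    | .fin w => ∃ π : Fin w.length ≃ M.Node,
        (∀ i, M.label (π i) = w.get i) ∧ ∀ i j, M.le (π i) (π j) → i ≤ j
    | .inf w => ∃ π : ℕ ≃ M.Node,
        (∀ i, M.label (π i) = w i) ∧ ∀ i j, M.le (π i) (π j) → i ≤ j}

section Concat

variable {ι : Type}

/-- A node of a disjoint union of charts, as an index and a node of the chart at that index. -/
def concatNode (M : ι → Chart P V) :
    (Σ i, (M i).Send) ⊕ (Σ i, (M i).Recv) → Σ i, (M i).Node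
  | .inl s => ⟨s.1, .inl s.2⟩
  | .inr r => ⟨r.1, .inr r.2⟩

/-- The concatenation of a finite or infinite sequence of charts: the disjoint union where, on
each process, the nodes of earlier charts come before the nodes of later charts. -/
def concat [LT ι] (M : ι → Chart P V) : Chart P V where
  Send := Σ i, (M i).Send
  Recv := Σ i, (M i).Recv
  proc e := (M (concatNode M e).1).proc (concatNode M e).2
  link s := ((M s.1).link s.2).map fun r => ⟨s.1, r⟩
  label e := (M (concatNode M e).1).label (concatNode M e).2
  procLe p e e' :=
    (M (concatNode M e).1).proc (concatNode M e).2 = p ∧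
    (M (concatNode M e').1).proc (concatNode M e').2 = p ∧
    Sigma.Lex (· < ·) (fun i => (M i).procLe p) (concatNode M e) (concatNode M e')

end Concat

/-- The chart without event nodes. -/
def empty (P V : Type*) : Chart P V where
  Send := Empty
  Recv := Empty
  proc := Sum.elim Empty.elim Empty.elim
  link := Empty.elim
  label := Sum.elim Empty.elim Empty.elim
  procLe _ _ _ := False

/-- The chart of the single message exchange `p → q : m`. -/
def exchange (p q : P) (m : V) : Chart P V where
  Send := Unit
  Recv := Unit
  proc := Sum.elim (fun _ => p) (fun _ => q)
  link _ := some ()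
  label := Sum.elim (fun _ => .send p q m) (fun _ => .recv p q m)
  procLe a e e' := Sum.elim (fun _ => p) (fun _ => q) e = a ∧
    Sum.elim (fun _ => p) (fun _ => q) e' = a ∧ (e = .inl () ∨ e' = .inr ())

theorem empty_isBMSC : (empty P V).IsBMSC where
  link_injective s := s.elim
  link_surjective r := r.elim
  procLe_proc _ _ _ h := h.elim
  procLe_refl e := by rcases e with e | e <;> exact e.elim
  procLe_trans _ _ _ _ h := h.elim
  procLe_total _ e := by rcases e with e | e <;> exact e.elim
  le_antisymm e := by rcases e with e | e <;> exact e.elim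
  label_link s := s.elim
  label_unmatched s := s.elim
  fifo := fun _ _ s => s.elim
  link_total s := s.elim
  finite_node := inferInstanceAs (Finite (Empty ⊕ Empty))

theorem exchange_le (p q : P) (m : V) (e e' : (exchange p q m).Node)
    (h : (exchange p q m).le e e') : e = e' ∨ e = .inl () ∨ e' = .inr () := by
  induction h with
  | refl => exact Or.inl rfl
  | tail _ h ih =>
    cases h with
    | proc a _ _ h =>
      rcases h.2.2 with h' | h'
      · subst h'
        rcases ih with ih | ih | ih
        · exact Or.inr (Or.inl ih)
        · exact Or.inr (Or.inl ih)
        · cases ih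
      · exact Or.inr (Or.inr h')
    | link => exact Or.inr (Or.inr rfl)

theorem exchange_isBMSC (p q : P) (m : V) : (exchange p q m).IsBMSC where
  link_injective _ _ _ _ _ := rfl
  link_surjective _ := ⟨(), rfl⟩
  procLe_proc _ _ _ h := ⟨h.1, h.2.1⟩
  procLe_refl e := ⟨rfl, rfl, by
    rcases e with e | e
    · exact Or.inl rfl
    · exact Or.inr rfl⟩
  procLe_trans a e e' e'' h h' := by
    refine ⟨h.1, h'.2.1, ?_⟩
    rcases h.2.2 with h1 | h1
    · exact Or.inl h1
    · rcases h'.2.2 with h2 | h2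
      · rw [h1] at h2
        cases h2
      · exact Or.inr h2
  procLe_total a e e' h h' := by
    rcases e with e | e
    · exact Or.inl ⟨h, h', Or.inl rfl⟩
    · exact Or.inr ⟨h', h, Or.inr rfl⟩
  le_antisymm e e' h h' := by
    rcases exchange_le p q m _ _ h with h1 | h1 | h1
    · exact h1
    · rcases exchange_le p q m _ _ h' with h2 | h2 | h2
      · exact h2.symm
      · exact h1.trans h2.symm
      · rw [h1] at h2
        cases h2
    · rcases exchange_le p q m _ _ h' with h2 | h2 | h2
      · exact h2.symm
      · rw [h1] at h2
        cases h2
      · exact h2.trans h1.symm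
  label_link _ _ _ := ⟨m, rfl, rfl⟩
  label_unmatched _ h := nomatch h
  fifo := by
    intro a b s₁ s₂ m₁ m₂ h₁ h₂ _
    refine ⟨nofun, fun r₁ r₂ _ _ => ?_⟩
    have hb : q = b := by
      have h : Event.send p q m = Event.send a b m₁ := h₁
      injection h
    exact ⟨hb, hb, Or.inr rfl⟩
  link_total _ := nofun
  finite_node := inferInstanceAs (Finite (Unit ⊕ Unit))

end Chart

/-! ### High-level message sequence charts -/

/-- A high-level message sequence chart. Every vertex is reachable from the initial vertex, and
every initial path can be completed to a maximal one (infinite, or ending in a terminal vertex):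
as all vertices are reachable, this says that every non-terminal vertex has a successor. -/
structure HMSC (P V : Type*) where
  Vertex : Type*
  finite_vertex : Finite Vertex
  edge : Vertex → Vertex → Prop
  start : Vertex
  terminal : Set Vertex
  chart : Vertex → {M : Chart P V // M.IsBMSC}
  reachable : ∀ v, Relation.ReflTransGen edge start v
  completable : ∀ v, v ∉ terminal → ∃ v', edge v v'

/-- The language of an HMSC: the union of the languages of the concatenated charts along its
maximal initial paths, finite (ending in a terminal vertex) and infinite. -/
def HMSC.language {P V : Type*} (H : HMSC P V) : Set (Word (Event P V)) :=
  {x | (∃ (n : ℕ) (ρ : Fin (n + 1) → H.Vertex),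
          ρ 0 = H.start ∧ (∀ i : Fin n, H.edge (ρ i.castSucc) (ρ i.succ)) ∧
          ρ (Fin.last n) ∈ H.terminal ∧
          x ∈ (Chart.concat fun i => (H.chart (ρ i)).1).language) ∨
       (∃ ρ : ℕ → H.Vertex,
          ρ 0 = H.start ∧ (∀ i, H.edge (ρ i) (ρ (i + 1))) ∧
          x ∈ (Chart.concat fun i => (H.chart (ρ i)).1).language)}

/-! ### Global types -/

/-- The terms of the grammar of global types, with recursion variables from `T`. The constructor
`choice p n q m G` is the sum of the branches `p → q i : m i . G i` over the non-empty finite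
index set `Fin (n + 1)`. -/
inductive GlobalTerm (P V T : Type*) where
  | done
  | choice (p : P) (n : ℕ) (q : Fin (n + 1) → P) (m : Fin (n + 1) → V)
      (G : Fin (n + 1) → GlobalTerm P V T)
  | mu (t : T) (G : GlobalTerm P V T)
  | var (t : T)

namespace GlobalTerm

variable {P V T : Type*}

/-- The set of subterms. -/
def subterms : GlobalTerm P V T → Set (GlobalTerm P V T)
  | done => {done}
  | choice p n q m G => insert (choice p n q m G) (⋃ i, subterms (G i))
  | mu t G => insert (mu t G) (subterms G)
  | var t => {var t}

/-- The variables with a free occurrence. -/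
def freeVars : GlobalTerm P V T → Set T
  | done => ∅
  | choice _ _ _ _ G => ⋃ i, freeVars (G i)
  | mu t G => freeVars G \ {t}
  | var t => {t}

/-- The list of the variables of all binders, with repetitions. -/
def binders : GlobalTerm P V T → List T
  | done => []
  | choice _ _ _ _ G => (List.ofFn fun i => binders (G i)).flatten
  | mu t G => t :: binders G
  | var _ => []

/-- The variables with a free occurrence that is not preceded by a message. -/
def unguardedVars : GlobalTerm P V T → Set T
  | done => ∅
  | choice _ _ _ _ _ => ∅
  | mu t G => unguardedVars G \ {t}
  | var t => {t}

/-- `G` is a global type: the branches of each choice are distinguishable, recursion is guarded,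
all variables are bound, and different binders bind different variables. -/
structure IsGlobalType (G : GlobalTerm P V T) : Prop where
  distinguishable : ∀ p n q m G', choice p n q m G' ∈ G.subterms →
    ∀ i j, i ≠ j → q i ≠ q j ∨ m i ≠ m j
  guarded : ∀ t G', mu t G' ∈ G.subterms → t ∉ G'.unguardedVars
  closed : G.freeVars = ∅
  binders_nodup : G.binders.Nodup

/-- Terms, and pairs of a choice and the index of one of its branches. -/
inductive Position (P V T : Type*) where
  | term (G : GlobalTerm P V T)
  | branch (p : P) (n : ℕ) (q : Fin (n + 1) → P) (m : Fin (n + 1) → V)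
      (G : Fin (n + 1) → GlobalTerm P V T) (j : Fin (n + 1))

/-- The subterms of `G`, and the pairs of a choice occurring in `G` and one of its indices. -/
def positions (G : GlobalTerm P V T) : Set (Position P V T) :=
  {x | match x with
    | .term G' => G' ∈ G.subterms
    | .branch p n q m G' _ => choice p n q m G' ∈ G.subterms}

theorem finite_subterms (G : GlobalTerm P V T) : G.subterms.Finite := by
  induction G with
  | done => exact Set.finite_singleton _
  | choice p n q m G ih => exact (Set.finite_iUnion ih).insert _
  | mu t G ih => exact ih.insert _
  | var t => exact Set.finite_singleton _

theorem finite_positions (G : GlobalTerm P V T) : Finite G.positions := by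
  let F : GlobalTerm P V T → Set (Position P V T) := fun A =>
    insert (.term A) (match A with
      | choice p n q m G' => Set.range (Position.branch p n q m G')
      | _ => ∅)
  have hF : ∀ A, (F A).Finite := by
    intro A
    refine Set.Finite.insert _ ?_
    cases A
    case choice p n q m G' => exact Set.finite_range _
    all_goals exact Set.finite_empty
  refine ((finite_subterms G).biUnion fun A _ => hF A).subset ?_
  rintro (A | ⟨p, n, q, m, G', j⟩) h
  · exact Set.mem_biUnion (show A ∈ G.subterms from h) (Set.mem_insert _ _)
  · exact Set.mem_biUnion (show choice p n q m G' ∈ G.subterms from h)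
      (Set.mem_insert_of_mem _ ⟨j, rfl⟩)

theorem self_mem_subterms (G : GlobalTerm P V T) : G ∈ G.subterms := by
  cases G <;> simp [subterms]

theorem subterms_trans {A B C : GlobalTerm P V T} (h : A ∈ B.subterms) (h' : B ∈ C.subterms) :
    A ∈ C.subterms := by
  induction C with
  | done => cases h'; exact h
  | choice p n q m G ih =>
    rcases h' with rfl | h'
    · exact h
    · obtain ⟨i, hi⟩ := Set.mem_iUnion.1 h'
      exact Or.inr (Set.mem_iUnion.2 ⟨i, ih i hi⟩)
  | mu t G ih =>
    rcases h' with rfl | h'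
    · exact h
    · exact Or.inr (ih h')
  | var t => cases h'; exact h

theorem branch_mem {G : GlobalTerm P V T} {p : P} {n : ℕ} {q : Fin (n + 1) → P}
    {m : Fin (n + 1) → V} {G' : Fin (n + 1) → GlobalTerm P V T}
    (h : choice p n q m G' ∈ G.subterms) (j : Fin (n + 1)) : G' j ∈ G.subterms :=
  subterms_trans (B := choice p n q m G')
    (Or.inr (Set.mem_iUnion.2 ⟨j, self_mem_subterms _⟩)) h

theorem mu_mem {G : GlobalTerm P V T} {t : T} {G' : GlobalTerm P V T}
    (h : mu t G' ∈ G.subterms) : G' ∈ G.subterms :=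
  subterms_trans (B := mu t G') (Or.inr (self_mem_subterms _)) h

theorem var_mem {t : T} {G : GlobalTerm P V T} (h : var t ∈ G.subterms) :
    t ∈ G.freeVars ∨ ∃ G', mu t G' ∈ G.subterms := by
  induction G with
  | done => cases h
  | choice p n q m G ih =>
    rcases h with h | h
    · cases h
    · obtain ⟨i, hi⟩ := Set.mem_iUnion.1 h
      rcases ih i hi with h' | ⟨G', h'⟩
      · exact Or.inl (Set.mem_iUnion.2 ⟨i, h'⟩)
      · exact Or.inr ⟨G', Or.inr (Set.mem_iUnion.2 ⟨i, h'⟩)⟩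
  | mu s G ih =>
    rcases h with h | h
    · cases h
    · by_cases hs : t = s
      · subst hs
        exact Or.inr ⟨G, Or.inl rfl⟩
      · rcases ih h with h' | ⟨G', h'⟩
        · exact Or.inl ⟨h', hs⟩
        · exact Or.inr ⟨G', Or.inr h'⟩
  | var s => cases h; exact Or.inl rfl

/-! #### The language of a global type -/

/-- The transitions of the automaton of a global type. -/
inductive Trans : Position P V T → Option (Event P V) → Position P V T → Prop where
  | mu (t : T) (G : GlobalTerm P V T) : Trans (.term (.mu t G)) none (.term G)
  | var (t : T) (G : GlobalTerm P V T) : Trans (.term (.var t)) none (.term (.mu t G))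
  | send (p : P) (n : ℕ) (q : Fin (n + 1) → P) (m : Fin (n + 1) → V)
      (G : Fin (n + 1) → GlobalTerm P V T) (j : Fin (n + 1)) :
      Trans (.term (.choice p n q m G)) (some (.send p (q j) (m j))) (.branch p n q m G j)
  | recv (p : P) (n : ℕ) (q : Fin (n + 1) → P) (m : Fin (n + 1) → V)
      (G : Fin (n + 1) → GlobalTerm P V T) (j : Fin (n + 1)) :
      Trans (.branch p n q m G j) (some (.recv p (q j) (m j))) (.term (G j))

/-- The automaton of a global type. -/
def automaton (G : GlobalTerm P V T) : StateMachine (Event P V) where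
  State := G.positions
  finite_state := finite_positions G
  trans x a y := Trans x.1 a y.1
  start := ⟨.term G, self_mem_subterms G⟩
  final := {x | x.1 = .term .done}

/-- The language `L(G)` of a global type. -/
def language (G : GlobalTerm P V T) : Set (Word (Event P V)) := G.automaton.language

/-! #### The HMSC of a global type -/

/-- The edges of the HMSC of a global type. -/
inductive Edge : Position P V T → Position P V T → Prop where
  | mu (t : T) (G : GlobalTerm P V T) : Edge (.term (.mu t G)) (.term G)
  | var (t : T) (G : GlobalTerm P V T) : Edge (.term (.var t)) (.term (.mu t G))
  | choose (p : P) (n : ℕ) (q : Fin (n + 1) → P) (m : Fin (n + 1) → V)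
      (G : Fin (n + 1) → GlobalTerm P V T) (j : Fin (n + 1)) :
      Edge (.term (.choice p n q m G)) (.branch p n q m G j)
  | next (p : P) (n : ℕ) (q : Fin (n + 1) → P) (m : Fin (n + 1) → V)
      (G : Fin (n + 1) → GlobalTerm P V T) (j : Fin (n + 1)) :
      Edge (.branch p n q m G j) (.term (G j))

/-- The BMSC at a vertex of the HMSC of a global type. -/
def chartAt : Position P V T → {M : Chart P V // M.IsBMSC}
  | .term _ => ⟨Chart.empty P V, Chart.empty_isBMSC⟩
  | .branch p _ q m _ j => ⟨Chart.exchange p (q j) (m j), Chart.exchange_isBMSC p (q j) (m j)⟩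

theorem reachable_aux (G A B : GlobalTerm P V T) (hA : A ∈ G.subterms) (hB : B ∈ A.subterms) :
    Relation.ReflTransGen (fun x y : G.positions => Edge x.1 y.1)
      ⟨.term A, hA⟩ ⟨.term B, subterms_trans hB hA⟩ := by
  induction A with
  | done => cases hB; exact .refl
  | choice p n q m G' ih =>
    rcases hB with rfl | hB
    · exact .refl
    · obtain ⟨i, hi⟩ := Set.mem_iUnion.1 hB
      exact .head (b := ⟨.branch p n q m G' i, hA⟩) (Edge.choose p n q m G' i)
        (.head (b := ⟨.term (G' i), branch_mem hA i⟩) (Edge.next p n q m G' i)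
          (ih i (branch_mem hA i) hi))
  | mu t G' ih =>
    rcases hB with rfl | hB
    · exact .refl
    · exact .head (b := ⟨.term G', mu_mem hA⟩) (Edge.mu t G') (ih (mu_mem hA) hB)
  | var t => cases hB; exact .refl

/-- The HMSC `H(G)` of a global type `G`. -/
def toHMSC (G : GlobalTerm P V T) (hG : G.IsGlobalType) : HMSC P V where
  Vertex := G.positions
  finite_vertex := finite_positions G
  edge x y := Edge x.1 y.1
  start := ⟨.term G, self_mem_subterms G⟩
  terminal := {x | x.1 = .term .done}
  chart x := chartAt x.1
  reachable := by
    rintro ⟨A | ⟨p, n, q, m, G', j⟩, h⟩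
    · exact reachable_aux G G A (self_mem_subterms G) h
    · exact (reachable_aux G G _ (self_mem_subterms G) h).tail (Edge.choose p n q m G' j)
  completable := by
    rintro ⟨A | ⟨p, n, q, m, G', j⟩, h⟩ hv
    · cases A with
      | done => exact absurd rfl hv
      | choice p n q m G' => exact ⟨⟨.branch p n q m G' 0, h⟩, Edge.choose p n q m G' 0⟩
      | mu t G' => exact ⟨⟨.term G', mu_mem h⟩, Edge.mu t G'⟩
      | var t =>
        rcases var_mem h with h' | ⟨G', h'⟩
        · rw [hG.closed] at h'
          exact h'.elim
        · exact ⟨⟨.term (.mu t G'), h'⟩, Edge.var t G'⟩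
    · exact ⟨⟨.term (G' j), branch_mem h j⟩, Edge.next p n q m G' j⟩

end GlobalTerm

end MST

/-!
Runs of the automaton of `G` and paths of the HMSC `H(G)` are the same sequences of positions: each
edge carries at most one event, a send on entering a branch and the matching reception on leaving
it (`trans_iff`). Along a path, the event nodes of the concatenated chart therefore correspond to
the moves of the run that carry a letter (`Labels.key`), and the order of the chart is generated by
constraints between moves (`Dep`): the events of one process keep their order, and a send comes
before its reception. So the language of the chart of a path consists of the words that read the
letters of the run in an order respecting these constraints (`IsLin`,
`Labels.exists_equiv_iff`).

The trace of the run reads the letters in their original order and is one of these words, which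
gives `L(G) ⊆ L(H(G))`. As the closure is monotone and idempotent, the equality of the closures
follows from `L(H(G)) ⊆ C^∼(L(G))`. For a finite linearisation, the trace is reached by sorting:
the last letter of the run is moved to the end past letters of other processes that are not
constrained to precede it (`indist_move`). Each of these transpositions is a swap; if the two events are
a send and a reception on the same channel, the side condition of the fourth rule holds because
every reception read so far has its send among the events read so far, and so has the pending
reception (`countRecv_lt_countSend`). A finite prefix of an infinite linearisation is extended by
the missing letters before some bound in their original order, and the result is sorted into a
prefix of the trace (`IsLin.exists_isTrace_inf`).
-/

namespace MST

/-! ### Closure under indistinguishability -/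

theorem Swap.append_right {P V : Type*} {u v : List (Event P V)} (h : Swap u v)
    (x : List (Event P V)) : Swap (u ++ x) (v ++ x) := by
  cases h <;> simp only [List.append_assoc, List.cons_append]
  · exact .send_send _ _ _ _ _ _ _ _ ‹_›
  · exact .recv_recv _ _ _ _ _ _ _ _ ‹_›
  · exact .send_recv _ _ _ _ _ _ _ _ ‹_›
  · exact .same_channel _ _ _ _ _ _ ‹_›

theorem Indist.append_right {P V : Type*} {u v : List (Event P V)} (h : Indist u v)
    (x : List (Event P V)) : Indist (u ++ x) (v ++ x) := by
  induction h with
  | rel _ _ h => exact .rel _ _ (h.append_right x)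
  | refl => exact .refl _
  | symm _ _ _ ih => exact .symm _ _ ih
  | trans _ _ _ _ _ ih ih' => exact .trans _ _ _ ih ih'

theorem InfPrec.trans {P V : Type*} {u v w : ℕ → Event P V} (h : InfPrec u v)
    (h' : InfPrec v w) : InfPrec u w := by
  intro n
  obtain ⟨k, x, hx⟩ := h n
  obtain ⟨k', y, hy⟩ := h' k
  refine ⟨k', x ++ y, ?_⟩
  rw [← List.append_assoc]
  exact .trans _ _ _ (hx.append_right y) hy

theorem closure_mono {P V : Type*} {L L' : Set (Word (Event P V))} (h : L ⊆ L') :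
    closure L ⊆ closure L' := by
  rintro (w | w) ⟨u, hu, hw⟩
  · exact ⟨u, h hu, hw⟩
  · exact ⟨u, h hu, hw⟩

theorem closure_subset_of_subset_closure {P V : Type*} {L L' : Set (Word (Event P V))}
    (h : L ⊆ closure L') : closure L ⊆ closure L' := by
  rintro (w | w) ⟨u, hu, hw⟩
  · obtain ⟨v, hv, huv⟩ := h hu
    exact ⟨v, hv, .trans _ _ _ hw huv⟩
  · obtain ⟨v, hv, huv⟩ := h hu
    exact ⟨v, hv, hw.trans huv⟩

/-! ### Linearisations of a sequence of letters and silent moves -/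

variable {P V : Type*}

/-- The process that performs an event. -/
def Event.actor : Event P V → P
  | .send p _ _ => p
  | .recv _ q _ => q

/-- The order constraints between the letters of a sequence: of two letters of one process the
first comes first, and a send comes before a matching reception directly after it. -/
def Dep (a : ℕ → Option (Event P V)) (i j : ℕ) : Prop :=
  i < j ∧ ∃ e e', a i = some e ∧ a j = some e' ∧
    (e.actor = e'.actor ∨ j = i + 1 ∧ ∃ p q m, e = .send p q m ∧ e' = .recv p q m)

/-- In the sequence `a`, every reception directly follows the matching send. -/
def Matched (a : ℕ → Option (Event P V)) : Prop :=
  ∀ k p q m, a k = some (.recv p q m) → ∃ k', k = k' + 1 ∧ a k' = some (.send p q m)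

/-- The word `w`, finite or infinite according to the index type `ι`, arises by reading the
letters of `a` in the order given by `f`, which lists the position of each letter once and
respects `Dep`. -/
structure IsLin {ι : Type} [LE ι] (a : ℕ → Option (Event P V)) (w : ι → Event P V)
    (f : ι → ℕ) : Prop where
  injective : Function.Injective f
  label : ∀ i, a (f i) = some (w i)
  surjective : ∀ k e, a k = some e → ∃ i, f i = k
  le_of_dep : ∀ i j, Dep a (f i) (f j) → i ≤ j

/-- The side condition of the swap on one channel: if `l` contains the send before each of its
receptions on the channel, and also a send whose reception it lacks, then it has more sends than
receptions. -/
theorem countRecv_lt_countSend {a : ℕ → Option (Event P V)} (ha : Matched a) {l : List ℕ}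
    (hl : l.Nodup) {p q : P} (hr : ∀ k m, k + 1 ∈ l → a (k + 1) = some (.recv p q m) → k ∈ l)
    {k₀ : ℕ} {m₀ : V} (hk : k₀ ∈ l) (hs : a k₀ = some (.send p q m₀)) (hk' : k₀ + 1 ∉ l) :
    countRecv p q (l.filterMap a) < countSend p q (l.filterMap a) := by
  classical
  unfold countRecv countSend
  rw [List.countP_filterMap, List.countP_filterMap, List.countP_eq_length_filter,
    List.countP_eq_length_filter]
  -- The predecessors of the receptions, together with `k₀`, are distinct sends.
  set R := l.filter fun k => ((a k).map fun e => decide (∃ m, e = Event.recv p q m)).getD false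
  set S := l.filter fun k => ((a k).map fun e => decide (∃ m, e = Event.send p q m)).getD false
  have hR : ∀ k ∈ R, ∃ k' m, k = k' + 1 ∧ k' + 1 ∈ l ∧ a (k' + 1) = some (.recv p q m) ∧
      a k' = some (.send p q m) := by
    intro k hk
    obtain ⟨h1, h2⟩ := List.mem_filter.1 hk
    obtain ⟨e, he⟩ : ∃ e, a k = some e := by
      cases he : a k with
      | none => simp [he] at h2
      | some e => exact ⟨e, rfl⟩
    obtain ⟨m, rfl⟩ : ∃ m, e = Event.recv p q m := by simpa [he] using h2
    obtain ⟨k', rfl, h4⟩ := ha _ _ _ _ he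
    exact ⟨k', m, rfl, h1, he, h4⟩
  have hnd : (k₀ :: R.map Nat.pred).Nodup := by
    refine List.nodup_cons.2 ⟨?_, ?_⟩
    · intro h
      obtain ⟨k, hk1, hk2⟩ := List.mem_map.1 h
      obtain ⟨k', m, rfl, h1, -⟩ := hR k hk1
      simp only [Nat.pred_succ] at hk2
      exact hk' (hk2 ▸ h1)
    · refine List.Nodup.map_on ?_ (hl.filter _)
      intro x hx y hy hxy
      obtain ⟨x', -, rfl, -⟩ := hR x hx
      obtain ⟨y', -, rfl, -⟩ := hR y hy
      simpa using hxy
  have hsub : k₀ :: R.map Nat.pred ⊆ S := by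
    intro k hk1
    rcases List.mem_cons.1 hk1 with rfl | hk1
    · exact List.mem_filter.2 ⟨hk, by simp [hs]⟩
    · obtain ⟨k, hkR, rfl⟩ := List.mem_map.1 hk1
      obtain ⟨k', m, rfl, h1, h2, h3⟩ := hR k hkR
      exact List.mem_filter.2 ⟨hr _ _ h1 h2, by simp [h3]⟩
  have := (List.subperm_of_subset hnd hsub).length_le
  simp only [List.length_cons, List.length_map] at this
  omega

/-- The position `N` may be moved to the end of a linearisation of the letters up to `N`. -/
theorem indist_move {a : ℕ → Option (Event P V)} (ha : Matched a) {N : ℕ} {e : Event P V}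
    (he : a N = some e) (l₂ : List ℕ) : ∀ l₁ : List ℕ, (l₁ ++ l₂).Nodup →
    (∀ k, k ∈ l₁ ++ l₂ ↔ k < N ∧ (a k).isSome) →
    (l₁ ++ l₂).Pairwise (fun x y => ¬ Dep a y x) → (∀ x ∈ l₂, ¬ Dep a x N) →
    Indist ((l₁ ++ N :: l₂).filterMap a) ((l₁ ++ l₂).filterMap a ++ [e]) := by
  induction l₂ with
  | nil =>
    intro l₁ _ _ _ _
    simp only [List.filterMap_append, List.filterMap_cons, he, List.append_nil, List.filterMap_nil]
    exact .refl _
  | cons j l₂ ih =>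
    intro l₁ hnd hmem hpw hdep
    have hl : l₁ ++ j :: l₂ = (l₁ ++ [j]) ++ l₂ := by simp
    have hind := ih (l₁ ++ [j]) (hl ▸ hnd) (hl ▸ hmem) (hl ▸ hpw)
      fun x hx => hdep x (List.mem_cons_of_mem _ hx)
    rw [← hl] at hind
    refine .trans _ _ _ ?_ hind
    obtain ⟨hjN, hj⟩ := (hmem j).1 (by simp)
    obtain ⟨e', he'⟩ := Option.isSome_iff_exists.1 hj
    have hact : e'.actor ≠ e.actor := fun h =>
      hdep j (by simp) ⟨hjN, e', e, he', he, Or.inl h⟩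
    have hnd1 : l₁.Nodup := (List.nodup_append.1 hnd).1
    have hj1 : j ∉ l₁ := fun h => (List.nodup_append.1 hnd).2.2 j h j (by simp) rfl
    have hN1 : N ∉ l₁ := fun h => lt_irrefl N ((hmem N).1 (List.mem_append_left _ h)).1
    have hpw' := List.pairwise_append.1 hpw
    have hlink : ∀ k p q m, a k = some (.send p q m) → a (k + 1) = some (.recv p q m) →
        Dep a k (k + 1) := fun k p q m h h' =>
      ⟨k.lt_succ_self, _, _, h, h', Or.inr ⟨rfl, p, q, m, rfl, rfl⟩⟩
    have hr : ∀ p q k m, k + 1 ∈ l₁ → a (k + 1) = some (.recv p q m) → k ∈ l₁ := by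
      intro p q k m hk hak
      obtain ⟨k', hk', hs⟩ := ha _ _ _ _ hak
      obtain rfl : k = k' := by omega
      have hkN := ((hmem (k + 1)).1 (List.mem_append_left _ hk)).1
      rcases List.mem_append.1 ((hmem k).2 ⟨by omega, by simp [hs]⟩) with h | h
      · exact h
      · exact (hpw'.2.2 _ hk _ h (hlink _ _ _ _ hs hak)).elim
    have hcountj : ∀ p q m, e' = .recv p q m →
        countRecv p q (l₁.filterMap a) < countSend p q (l₁.filterMap a) := by
      rintro p q m rfl
      obtain ⟨k, rfl, hs⟩ := ha _ _ _ _ he'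
      refine countRecv_lt_countSend ha hnd1 (hr p q) (k₀ := k) ?_ hs hj1
      rcases List.mem_append.1 ((hmem k).2 ⟨by omega, by simp [hs]⟩) with h | h
      · exact h
      · rcases List.mem_cons.1 h with h | h
        · omega
        · exact ((List.pairwise_cons.1 hpw'.2.1).1 k h (hlink _ _ _ _ hs he')).elim
    have hcountN : ∀ p q m, e = .recv p q m →
        countRecv p q (l₁.filterMap a) < countSend p q (l₁.filterMap a) := by
      rintro p q m rfl
      obtain ⟨k, rfl, hs⟩ := ha _ _ _ _ he
      refine countRecv_lt_countSend ha hnd1 (hr p q) (k₀ := k) ?_ hs hN1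
      rcases List.mem_append.1 ((hmem k).2 ⟨by omega, by simp [hs]⟩) with h | h
      · exact h
      · exact (hdep k h (hlink _ _ _ _ hs he)).elim
    simp only [List.filterMap_append, List.filterMap_cons, he, he', List.append_assoc,
      List.cons_append, List.nil_append]
    rcases e with ⟨p, q, m⟩ | ⟨p, q, m⟩ <;> rcases e' with ⟨r, s, m'⟩ | ⟨r, s, m'⟩
    · exact .rel _ _ (.send_send _ _ _ _ _ _ _ _ (Ne.symm hact))
    · by_cases h : p = r ∧ q = s
      · obtain ⟨rfl, rfl⟩ := h
        exact .rel _ _ (.same_channel _ _ _ _ _ _ (hcountj _ _ _ rfl))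
      · exact .rel _ _ (.send_recv _ _ _ _ _ _ _ _ ⟨Ne.symm hact, not_and_or.1 h⟩)
    · by_cases h : r = p ∧ s = q
      · obtain ⟨rfl, rfl⟩ := h
        exact .symm _ _ (.rel _ _ (.same_channel _ _ _ _ _ _ (hcountN _ _ _ rfl)))
      · exact .symm _ _ (.rel _ _ (.send_recv _ _ _ _ _ _ _ _ ⟨hact, not_and_or.1 h⟩))
    · exact .rel _ _ (.recv_recv _ _ _ _ _ _ _ _ (Ne.symm hact))

/-- Any two linearisations of the first `N` entries are indistinguishable: sort by moving the
last letter to the end. -/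
theorem indist_of_pairwise {a : ℕ → Option (Event P V)} (ha : Matched a) (N : ℕ) :
    ∀ l : List ℕ, l.Nodup → (∀ k, k ∈ l ↔ k < N ∧ (a k).isSome) →
    l.Pairwise (fun x y => ¬ Dep a y x) →
    Indist (l.filterMap a) ((List.range N).filterMap a) := by
  induction N with
  | zero =>
    intro l _ hmem _
    obtain rfl : l = [] := List.eq_nil_iff_forall_not_mem.2 fun k hk => by simpa using (hmem k).1 hk
    exact .refl _
  | succ N ih =>
    intro l hnd hmem hpw
    rw [List.range_succ, List.filterMap_append]
    cases he : a N with
    | none =>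
      simp only [List.filterMap_cons, he, List.filterMap_nil, List.append_nil]
      refine ih l hnd (fun k => (hmem k).trans (and_congr_left fun hk => ?_)) hpw
      have : k ≠ N := by rintro rfl; simp [he] at hk
      omega
    | some e =>
      obtain ⟨l₁, l₂, rfl⟩ := List.append_of_mem ((hmem N).2 ⟨N.lt_succ_self, by simp [he]⟩)
      have hsub : (l₁ ++ l₂).Sublist (l₁ ++ N :: l₂) :=
        (List.sublist_cons_self N l₂).append_left l₁
      have hN : N ∉ l₁ ++ l₂ := (List.nodup_cons.1 (List.nodup_middle.1 hnd)).1
      have hmem' : ∀ k, k ∈ l₁ ++ l₂ ↔ k < N ∧ (a k).isSome := by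
        intro k
        constructor
        · intro hk
          obtain ⟨h1, h2⟩ := (hmem k).1 (hsub.subset hk)
          have : k ≠ N := fun h => hN (h ▸ hk)
          exact ⟨by omega, h2⟩
        · rintro ⟨h1, h2⟩
          have := (hmem k).2 ⟨by omega, h2⟩
          have hkN : k ≠ N := by omega
          simpa [hkN] using this
      have hdep : ∀ x ∈ l₂, ¬ Dep a x N :=
        (List.pairwise_cons.1 (List.pairwise_append.1 hpw).2.1).1
      simp only [List.filterMap_cons, he, List.filterMap_nil]
      exact .trans _ _ _ (indist_move ha he l₂ l₁ (hnd.sublist hsub) hmem' (hpw.sublist hsub) hdep)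
        ((ih _ (hnd.sublist hsub) hmem' (hpw.sublist hsub)).append_right [e])

theorem reduceOption_takeInf {A : Type*} (a : ℕ → Option A) (n : ℕ) :
    (takeInf a n).reduceOption = (List.range n).filterMap a := by
  simp [takeInf, List.reduceOption, List.filterMap_map]

theorem filterMap_range_of_eq_none {A : Type*} {a : ℕ → Option A} {n m : ℕ} (h : n ≤ m)
    (ha : ∀ i, n ≤ i → a i = none) :
    (List.range m).filterMap a = (List.range n).filterMap a := by
  induction m, h using Nat.le_induction with
  | base => rfl
  | succ m hm ih => simp [List.range_succ, ih, ha m hm]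

/-- Finite traces do not depend on the bound after which all moves are silent. -/
theorem IsTrace.fin_eq {A : Type*} {a : ℕ → Option A} {w : List A} (h : IsTrace a (.fin w))
    {n : ℕ} (hn : ∀ i, n ≤ i → a i = none) : w = (takeInf a n).reduceOption := by
  obtain ⟨m, hm, rfl⟩ := h
  rw [reduceOption_takeInf, reduceOption_takeInf]
  rcases le_total n m with hnm | hnm
  · exact filterMap_range_of_eq_none hnm hn
  · exact (filterMap_range_of_eq_none hnm hm).symm

theorem IsLin.of_strictMono {ι : Type} [LinearOrder ι] {a : ℕ → Option (Event P V)}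
    {w : ι → Event P V} {f : ι → ℕ} (hf : StrictMono f) (hw : ∀ i, a (f i) = some (w i))
    (hs : ∀ k e, a k = some e → ∃ i, f i = k) : IsLin a w f :=
  ⟨hf.injective, hw, hs, fun _ _ h => (hf.lt_iff_lt.1 h.1).le⟩

/-- The erasure of the silent moves in a sequence with finitely many letters is a
linearisation. -/
theorem IsTrace.exists_isLin_fin {a : ℕ → Option (Event P V)} {w : List (Event P V)}
    (h : IsTrace a (.fin w)) : ∃ f : Fin w.length → ℕ, IsLin a w.get f := by
  obtain ⟨n, hn, rfl⟩ := h
  rw [reduceOption_takeInf]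
  set l := (List.range n).filter fun k => (a k).isSome with hl
  have hsome : ∀ k ∈ l, (a k).isSome := fun k hk => (List.mem_filter.1 hk).2
  have hmap : (List.map a l) = ((List.range n).filterMap a).map some := by
    rw [hl]
    clear hl hn hsome l
    induction List.range n with
    | nil => rfl
    | cons k l ih => cases hk : a k <;> simp [hk, ih]
  have hlen : ((List.range n).filterMap a).length = l.length := by
    simpa using (congrArg List.length hmap).symm
  refine ⟨fun i => l[i.1]'(hlen ▸ i.2), .of_strictMono ?_ ?_ ?_⟩
  · intro i j hij
    have hp : l.Pairwise (· < ·) := List.pairwise_lt_range.filter _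
    exact List.pairwise_iff_getElem.1 hp _ _ _ _ hij
  · intro i
    have h1 : (List.map a l)[i.1]'(by simpa using hlen ▸ i.2) =
        (((List.range n).filterMap a).map some)[i.1]'(by simp) := by
      simp only [hmap]
    simpa using h1
  · intro k e hk
    have hkn : k < n := by
      by_contra h
      rw [hn k (not_lt.1 h)] at hk
      cases hk
    obtain ⟨i, hi, rfl⟩ := List.getElem_of_mem
      (show k ∈ l from List.mem_filter.2 ⟨List.mem_range.2 hkn, by simp [hk]⟩)
    exact ⟨⟨i, hlen ▸ hi⟩, rfl⟩

theorem IsTrace.exists_isLin_inf {a : ℕ → Option (Event P V)} {w : ℕ → Event P V}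
    (h : IsTrace a (.inf w)) : ∃ f : ℕ → ℕ, IsLin a w f := by
  obtain ⟨φ, hφ, hw, hnone⟩ := h
  refine ⟨φ, .of_strictMono hφ hw fun k e hk => ?_⟩
  by_contra h
  rw [hnone k h] at hk
  cases hk

theorem IsLin.exists_isTrace_fin {a : ℕ → Option (Event P V)} (ha : Matched a)
    {w : List (Event P V)} {f : Fin w.length → ℕ} (h : IsLin a w.get f) :
    ∃ w₀, IsTrace a (.fin w₀) ∧ Indist w w₀ := by
  obtain ⟨N, hN⟩ : ∃ N, ∀ i, f i < N := by
    obtain ⟨b, hb⟩ := (Set.finite_range f).bddAbove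
    exact ⟨b + 1, fun i => Nat.lt_succ_of_le (hb ⟨i, rfl⟩)⟩
  refine ⟨_, ⟨N, fun k hk => ?_, rfl⟩, ?_⟩
  · cases he : a k with
    | none => rfl
    | some e =>
      obtain ⟨i, rfl⟩ := h.surjective k e he
      exact absurd (hN i) (by omega)
  · have hw : w = (List.ofFn f).filterMap a := by
      have : List.map some w = List.map a (List.ofFn f) := by
        conv_lhs => rw [← List.ofFn_get w]
        rw [List.map_ofFn, List.map_ofFn]
        congr 1
        funext i
        exact (h.label i).symm
      calc w = (List.map some w).filterMap id := by simp [List.filterMap_map]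
        _ = (List.ofFn f).filterMap a := by rw [this, List.filterMap_map]; rfl
    rw [reduceOption_takeInf]
    conv_lhs => rw [hw]
    refine indist_of_pairwise ha N _ (List.nodup_ofFn.2 h.injective) (fun k => ?_) ?_
    · rw [List.mem_ofFn]
      constructor
      · rintro ⟨i, rfl⟩
        exact ⟨hN i, by simp [h.label]⟩
      · rintro ⟨-, hk⟩
        obtain ⟨e, he⟩ := Option.isSome_iff_exists.1 hk
        exact h.surjective k e he
    · rw [List.pairwise_ofFn]
      intro i j hij hd
      exact absurd (h.le_of_dep _ _ hd) (not_le.2 hij)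

/-- The prefixes of a sequence of moves have as traces prefixes of the infinite trace. -/
theorem exists_takeInf_eq {A : Type*} {a : ℕ → Option A} {w : ℕ → A} {φ : ℕ → ℕ}
    (hφ : StrictMono φ) (hw : ∀ i, a (φ i) = some (w i))
    (hnone : ∀ k, k ∉ Set.range φ → a k = none) (N : ℕ) :
    ∃ k, (∀ i, i < k ↔ φ i < N) ∧ (List.range N).filterMap a = takeInf w k := by
  induction N with
  | zero => exact ⟨0, by simp, by simp [takeInf]⟩
  | succ N ih =>
    obtain ⟨k, hk, heq⟩ := ih
    by_cases hN : N ∈ Set.range φ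
    · obtain ⟨j, rfl⟩ := hN
      have hj : j = k := by
        have h1 : ¬ j < k := fun h => lt_irrefl _ ((hk j).1 h)
        have h2 : ¬ k < j := fun h => lt_irrefl _ ((hk k).2 (hφ h))
        omega
      subst hj
      refine ⟨j + 1, fun i => ?_, ?_⟩
      · rw [Nat.lt_succ_iff, Nat.lt_succ_iff, hφ.le_iff_le]
      · simp [List.range_succ, heq, hw, takeInf]
    · refine ⟨k, fun i => ?_, ?_⟩
      · rw [hk]
        have : φ i ≠ N := fun h => hN ⟨i, h⟩
        omega
      · simp [List.range_succ, heq, hnone N hN]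

/-- An infinite linearisation precedes the trace: a finite prefix is a linearisation of a set of
letters closed under `Dep`, and appending the missing letters before some bound in their
original order gives a linearisation of all letters before the bound. -/
theorem IsLin.exists_isTrace_inf {a : ℕ → Option (Event P V)} (ha : Matched a)
    {w : ℕ → Event P V} {f : ℕ → ℕ} (h : IsLin a w f) :
    ∃ w₀, IsTrace a (.inf w₀) ∧ InfPrec w w₀ := by
  have hinf : {k | (a k).isSome}.Infinite :=
    (Set.infinite_range_of_injective h.injective).mono
      (by rintro _ ⟨i, rfl⟩; simp [h.label])
  set φ := Nat.nth fun k => (a k).isSome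
  have hφ : StrictMono φ := Nat.nth_strictMono hinf
  have hrange : Set.range φ = {k | (a k).isSome} := Nat.range_nth_of_infinite hinf
  have hφs : ∀ i, (a (φ i)).isSome := fun i => Nat.nth_mem_of_infinite hinf i
  choose w₀ hw₀ using fun i => Option.isSome_iff_exists.1 (hφs i)
  have hnone : ∀ k, k ∉ Set.range φ → a k = none := by
    intro k hk
    rw [hrange] at hk
    simpa using hk
  refine ⟨w₀, ⟨φ, hφ, hw₀, hnone⟩, fun n => ?_⟩
  obtain ⟨N, hN⟩ : ∃ N, ∀ i < n, f i < N := by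
    obtain ⟨b, hb⟩ := ((Set.finite_lt_nat n).image f).bddAbove
    exact ⟨b + 1, fun i hi => Nat.lt_succ_of_le (hb ⟨i, hi, rfl⟩)⟩
  obtain ⟨k, -, hk⟩ := exists_takeInf_eq hφ hw₀ hnone N
  set l := (List.range n).map f with hl
  set t := (List.range N).filter fun k => decide (k ∉ l) && (a k).isSome with ht
  have hmeml : ∀ k, k ∈ l ↔ ∃ i < n, f i = k := by simp [hl]
  have hmemt : ∀ k, k ∈ t ↔ k < N ∧ k ∉ l ∧ (a k).isSome := by
    intro k
    rw [ht, List.mem_filter, List.mem_range, Bool.and_eq_true, decide_eq_true_iff]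
  have hlw : l.filterMap a = takeInf w n := by
    rw [hl, List.filterMap_map, takeInf, ← List.filterMap_eq_map]
    exact congrArg (fun g => List.filterMap g _) (funext fun i => h.label i)
  refine ⟨k, t.filterMap a, ?_⟩
  rw [← hk, ← hlw, ← List.filterMap_append]
  refine indist_of_pairwise ha N _ ?_ ?_ ?_
  · refine List.nodup_append.2 ⟨List.nodup_range.map h.injective, List.nodup_range.filter _, ?_⟩
    rintro x hx y hy rfl
    exact ((hmemt x).1 hy).2.1 hx
  · intro k
    rw [List.mem_append, hmemt]
    constructor
    · rintro (hk | hk)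
      · obtain ⟨i, hi, rfl⟩ := (hmeml k).1 hk
        exact ⟨hN i hi, by simp [h.label]⟩
      · exact ⟨hk.1, hk.2.2⟩
    · rintro ⟨h1, h2⟩
      by_cases hkl : k ∈ l
      · exact Or.inl hkl
      · exact Or.inr ⟨h1, hkl, h2⟩
  · refine List.pairwise_append.2 ⟨?_, ?_, ?_⟩
    · rw [hl, List.pairwise_map]
      exact List.pairwise_lt_range.imp fun hij hd =>
        absurd (h.le_of_dep _ _ hd) (not_le.2 hij)
    · exact (List.pairwise_lt_range.filter _).imp fun {x y} (hij : x < y) (hd : Dep a y x) =>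
        lt_asymm hij hd.1
    · intro x hx y hy hd
      obtain ⟨i, hi, rfl⟩ := (hmeml x).1 hx
      obtain ⟨e, he⟩ := Option.isSome_iff_exists.1 ((hmemt y).1 hy).2.2
      obtain ⟨j, rfl⟩ := h.surjective _ _ he
      exact ((hmemt _).1 hy).2.1
        ((hmeml _).2 ⟨j, lt_of_le_of_lt (h.le_of_dep _ _ hd) hi, rfl⟩)

/-! ### Charts along a path and their linearisations -/

namespace GlobalTerm

variable {T : Type*}

theorem chartAt_send (x : Position P V T) (s : (chartAt x).1.Send) :
    ∃ p n q m G j, x = .branch p n q m G j ∧ (chartAt x).1.proc (.inl s) = p ∧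
      (chartAt x).1.label (.inl s) = .send p (q j) (m j) := by
  rcases x with A | ⟨p, n, q, m, G, j⟩
  · exact s.elim
  · exact ⟨p, n, q, m, G, j, rfl, rfl, rfl⟩

theorem chartAt_recv (x : Position P V T) (r : (chartAt x).1.Recv) :
    ∃ p n q m G j, x = .branch p n q m G j ∧ (chartAt x).1.proc (.inr r) = q j ∧
      (chartAt x).1.label (.inr r) = .recv p (q j) (m j) := by
  rcases x with A | ⟨p, n, q, m, G, j⟩
  · exact r.elim
  · exact ⟨p, n, q, m, G, j, rfl, rfl, rfl⟩

theorem chartAt_proc (x : Position P V T) (e : (chartAt x).1.Node) :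
    (chartAt x).1.proc e = ((chartAt x).1.label e).actor := by
  rcases x with A | ⟨p, n, q, m, G, j⟩
  · exact e.elim Empty.elim Empty.elim
  · rcases e with e | e <;> rfl

instance (x : Position P V T) : Subsingleton (chartAt x).1.Send := by
  rcases x with A | ⟨p, n, q, m, G, j⟩
  · exact inferInstanceAs (Subsingleton Empty)
  · exact inferInstanceAs (Subsingleton Unit)

instance (x : Position P V T) : Subsingleton (chartAt x).1.Recv := by
  rcases x with A | ⟨p, n, q, m, G, j⟩
  · exact inferInstanceAs (Subsingleton Empty)
  · exact inferInstanceAs (Subsingleton Unit)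

theorem chartAt_link (x : Position P V T) (s : (chartAt x).1.Send) (r : (chartAt x).1.Recv) :
    (chartAt x).1.link s = some r := by
  rcases x with A | ⟨p, n, q, m, G, j⟩
  · exact s.elim
  · rfl

theorem not_procLe_recv_send (x : Position P V T) (s : (chartAt x).1.Send)
    (r : (chartAt x).1.Recv) (p : P) : ¬ (chartAt x).1.procLe p (.inr r) (.inl s) := by
  rcases x with A | ⟨p, n, q, m, G, j⟩
  · exact s.elim
  · rintro ⟨-, -, h | h⟩ <;> cases h

theorem procLe_send_recv (x : Position P V T) (s : (chartAt x).1.Send)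
    (r : (chartAt x).1.Recv) (h : (chartAt x).1.proc (.inl s) = (chartAt x).1.proc (.inr r)) :
    (chartAt x).1.procLe ((chartAt x).1.proc (.inl s)) (.inl s) (.inr r) := by
  rcases x with A | ⟨p, n, q, m, G, j⟩
  · exact s.elim
  · exact ⟨rfl, h.symm, Or.inl rfl⟩

/-- The sequence of moves `a` belongs to a path `pos` whose `i`-th position is entered by the move
before `v i` and left by the move `v i`: the letters of `a` are the sends on entering and the
receptions on leaving the branches on the path. -/
structure Labels {ι : Type} [LinearOrder ι] (v : ι → ℕ) (pos : ι → Position P V T)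
    (a : ℕ → Option (Event P V)) : Prop where
  strictMono : StrictMono v
  branch : ∀ i p n q m G j, pos i = .branch p n q m G j → ∃ k, v i = k + 1 ∧
    a k = some (.send p (q j) (m j)) ∧ a (k + 1) = some (.recv p (q j) (m j))
  letter : ∀ k e, a k = some e → ∃ i p n q m G j, pos i = .branch p n q m G j ∧
    (v i = k + 1 ∧ e = .send p (q j) (m j) ∨ v i = k ∧ e = .recv p (q j) (m j))

namespace Labels

variable {ι : Type} [LinearOrder ι] {v : ι → ℕ} {pos : ι → Position P V T}
  {a : ℕ → Option (Event P V)}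

theorem matched (h : Labels v pos a) : Matched a := by
  intro k p q m hk
  obtain ⟨i, p', n, q', m', G, j, hi, h1⟩ := h.letter _ _ hk
  obtain ⟨k', hv, hs, -⟩ := h.branch _ _ _ _ _ _ _ hi
  rcases h1 with ⟨-, h1⟩ | ⟨hvk, h1⟩
  · cases h1
  · injection h1 with e1 e2 e3
    subst e1 e2 e3
    exact ⟨k', hvk.symm.trans hv, hs⟩

/-- The chart of a path. -/
abbrev chart (pos : ι → Position P V T) : Chart P V :=
  Chart.concat fun i => (chartAt (pos i)).1

/-- The move at which an event node of the chart of a path is executed. -/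
def key (v : ι → ℕ) (pos : ι → Position P V T) : (chart pos).Node → ℕ
  | .inl s => v s.1 - 1
  | .inr r => v r.1

theorem key_send (h : Labels v pos a) (s : (chart pos).Send) :
    ∃ p q m, (chart pos).label (.inl s) = .send p q m ∧ v s.1 = key v pos (.inl s) + 1 ∧
      a (key v pos (.inl s)) = some (.send p q m) := by
  obtain ⟨p, n, q, m, G, j, hx, -, hl⟩ := chartAt_send _ s.2
  obtain ⟨k, hk, hs, -⟩ := h.branch _ _ _ _ _ _ _ hx
  have : key v pos (.inl s) = k := by simp [key, hk]
  exact ⟨p, q j, m j, hl, by rw [this, hk], by rw [this, hs]⟩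

theorem key_recv (h : Labels v pos a) (r : (chart pos).Recv) :
    ∃ p q m, (chart pos).label (.inr r) = .recv p q m ∧
      a (key v pos (.inr r)) = some (.recv p q m) := by
  obtain ⟨p, n, q, m, G, j, hx, -, hl⟩ := chartAt_recv _ r.2
  obtain ⟨k, hk, -, hs⟩ := h.branch _ _ _ _ _ _ _ hx
  have : key v pos (.inr r) = k + 1 := by simp [key, hk]
  exact ⟨p, q j, m j, hl, by rw [this, hs]⟩

theorem key_label (h : Labels v pos a) (e : (chart pos).Node) :
    a (key v pos e) = some ((chart pos).label e) := by
  rcases e with s | r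
  · obtain ⟨p, q, m, h1, -, h2⟩ := h.key_send s
    rw [h1, h2]
  · obtain ⟨p, q, m, h1, h2⟩ := h.key_recv r
    rw [h1, h2]

theorem key_injective (h : Labels v pos a) : Function.Injective (key v pos) := by
  have hsr : ∀ s r, key v pos (.inl s) ≠ key v pos (.inr r) := by
    intro s r he
    obtain ⟨_, _, _, -, -, h1⟩ := h.key_send s
    obtain ⟨_, _, _, -, h2⟩ := h.key_recv r
    rw [he, h2] at h1
    cases h1
  rintro (s | r) (s' | r') he
  · obtain ⟨_, _, _, -, h1, -⟩ := h.key_send s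
    obtain ⟨_, _, _, -, h2, -⟩ := h.key_send s'
    have hi : s.1 = s'.1 := h.strictMono.injective (by rw [h1, h2, he])
    obtain ⟨i, s⟩ := s
    obtain ⟨i', s'⟩ := s'
    obtain rfl : i = i' := hi
    rw [Subsingleton.elim s s']
  · exact (hsr _ _ he).elim
  · exact (hsr _ _ he.symm).elim
  · have hi : r.1 = r'.1 := h.strictMono.injective he
    obtain ⟨i, r⟩ := r
    obtain ⟨i', r'⟩ := r'
    obtain rfl : i = i' := hi
    rw [Subsingleton.elim r r']

theorem exists_key_eq (h : Labels v pos a) (k : ℕ) (e : Event P V) (hk : a k = some e) :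
    ∃ x, key v pos x = k := by
  obtain ⟨i, p, n, q, m, G, j, hi, h1⟩ := h.letter _ _ hk
  have hS : Nonempty ((chartAt (pos i)).1.Send) := by rw [hi]; exact ⟨()⟩
  have hR : Nonempty ((chartAt (pos i)).1.Recv) := by rw [hi]; exact ⟨()⟩
  rcases h1 with ⟨h1, -⟩ | ⟨h1, -⟩
  · exact ⟨.inl ⟨i, hS.some⟩, by simp [key, h1]⟩
  · exact ⟨.inr ⟨i, hR.some⟩, h1⟩

/-- Each generating pair of the order of the chart of a path is trivial or a constraint between
the moves. -/
theorem dep_of_step (h : Labels v pos a) {x y : (chart pos).Node} (hxy : (chart pos).Step x y) :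
    x = y ∨ Dep a (key v pos x) (key v pos y) := by
  cases hxy with
  | proc p _ _ hp =>
    obtain ⟨hx, hy, hlex⟩ := hp
    have hle : key v pos x ≤ key v pos y := by
      rw [Sigma.lex_iff] at hlex
      rcases hlex with hlt | ⟨heq, hle⟩
      · have hlt' := h.strictMono hlt
        rcases x with s | r <;> rcases y with s' | r' <;>
          simp only [Chart.concatNode, key] at hlt' ⊢ <;> omega
      · rcases x with ⟨i, s⟩ | ⟨i, r⟩ <;> rcases y with ⟨i', s'⟩ | ⟨i', r'⟩ <;>
          obtain rfl : i = i' := heq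
        · exact le_rfl
        · exact Nat.sub_le _ _
        · exact (not_procLe_recv_send _ _ _ _ hle).elim
        · exact le_rfl
    rcases hle.eq_or_lt with heq | hlt
    · exact Or.inl (h.key_injective heq)
    · refine Or.inr ⟨hlt, _, _, h.key_label x, h.key_label y, Or.inl ?_⟩
      exact (chartAt_proc _ _).symm.trans (hx.trans (hy.symm.trans (chartAt_proc _ _)))
  | link s r hl =>
    obtain ⟨i, s⟩ := s
    obtain ⟨r', -, rfl⟩ := Option.map_eq_some_iff.1 hl
    obtain ⟨p, n, q, m, G, j, hx, -, -⟩ := chartAt_send _ s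
    obtain ⟨k, hk, h1, h2⟩ := h.branch _ _ _ _ _ _ _ hx
    have hs : key v pos (.inl ⟨i, s⟩) = k := by simp [key, hk]
    have hr : key v pos (.inr ⟨i, r'⟩) = k + 1 := hk
    rw [hs, hr]
    exact Or.inr ⟨k.lt_succ_self, _, _, h1, h2, Or.inr ⟨rfl, _, _, _, rfl, rfl⟩⟩

theorem le_of_dep (h : Labels v pos a) {x y : (chart pos).Node}
    (hxy : Dep a (key v pos x) (key v pos y)) : (chart pos).le x y := by
  refine .single ?_
  obtain ⟨hlt, e, e', he, he', hd⟩ := hxy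
  obtain rfl := Option.some.inj (he.symm.trans (h.key_label x))
  obtain rfl := Option.some.inj (he'.symm.trans (h.key_label y))
  rcases hd with hd | ⟨hk, p, q, m, hx, hy⟩
  · refine .proc _ _ _ ⟨rfl, ?_, ?_⟩
    · exact (chartAt_proc _ _).trans (hd.symm.trans (chartAt_proc _ _).symm)
    · have hproc : (chart pos).proc x = (chart pos).proc y :=
        (chartAt_proc _ _).trans (hd.trans (chartAt_proc _ _).symm)
      rcases x with s | r <;> rcases y with s' | r'
      · refine .left _ _ (h.strictMono.lt_iff_lt.1 ?_)
        simp only [key] at hlt ⊢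
        omega
      · have hle : v s.1 ≤ v r'.1 := by
          simp only [key] at hlt
          omega
        obtain ⟨i, s⟩ := s
        obtain ⟨i', r'⟩ := r'
        rcases (h.strictMono.le_iff_le.1 hle).eq_or_lt with heq | hlt
        · obtain rfl : i = i' := heq
          exact .right _ _ (procLe_send_recv _ _ _ hproc)
        · exact .left _ _ hlt
      · refine .left _ _ (h.strictMono.lt_iff_lt.1 ?_)
        simp only [key] at hlt ⊢
        omega
      · exact .left _ _ (h.strictMono.lt_iff_lt.1 hlt)
  · rcases x with s | r
    · rcases y with s' | r'
      · obtain ⟨_, _, _, h1, -, -⟩ := h.key_send s'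
        rw [h1] at hy
        cases hy
      · obtain ⟨_, _, _, -, h1, -⟩ := h.key_send s
        rw [← hk] at h1
        have hi : s.1 = r'.1 := h.strictMono.injective h1
        obtain ⟨i, s⟩ := s
        obtain ⟨i', r'⟩ := r'
        obtain rfl : i = i' := hi
        refine .link _ _ ?_
        change ((chartAt (pos i)).1.link s).map _ = _
        rw [chartAt_link _ s r']
        rfl
    · obtain ⟨_, _, _, h1, -⟩ := h.key_recv r
      rw [h1] at hx
      cases hx

/-- Linearisations of the chart of a path correspond to linearisations of its moves. -/
theorem exists_equiv_iff (h : Labels v pos a) {κ : Type} [Preorder κ] (w : κ → Event P V) :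
    (∃ π : κ ≃ (chart pos).Node, (∀ i, (chart pos).label (π i) = w i) ∧
      ∀ i j, (chart pos).le (π i) (π j) → i ≤ j) ↔ ∃ f : κ → ℕ, IsLin a w f := by
  constructor
  · rintro ⟨π, hw, hle⟩
    refine ⟨key v pos ∘ π, h.key_injective.comp π.injective, fun i => ?_, fun k e hk => ?_,
      fun i j hd => hle _ _ (h.le_of_dep hd)⟩
    · rw [← hw]
      exact h.key_label _
    · obtain ⟨x, hx⟩ := h.exists_key_eq k e hk
      exact ⟨π.symm x, by simpa using hx⟩
  · rintro ⟨f, hf⟩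
    choose g hg using fun i => h.exists_key_eq _ _ (hf.label i)
    have hbij : Function.Bijective g := by
      refine ⟨fun i j hij => hf.injective ?_, fun x => ?_⟩
      · rw [← hg i, ← hg j, hij]
      · obtain ⟨i, hi⟩ := hf.surjective _ _ (h.key_label x)
        exact ⟨i, h.key_injective ((hg i).trans hi)⟩
    set π := Equiv.ofBijective g hbij
    refine ⟨π, fun i => ?_, fun i j hij => ?_⟩
    · have h1 := h.key_label (g i)
      rw [hg, hf.label] at h1
      exact (Option.some.inj h1).symm
    · have key_le : ∀ x y, (chart pos).le x y → π.symm x ≤ π.symm y := by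
        intro x y hxy
        induction hxy with
        | refl => exact le_rfl
        | @tail y z _ hyz ih =>
          refine ih.trans ?_
          rcases h.dep_of_step hyz with rfl | hd
          · exact le_rfl
          · refine hf.le_of_dep _ _ ?_
            have hπ : ∀ x, f (π.symm x) = key v pos x := fun x => by
              rw [← hg]
              exact congrArg (key v pos) (π.apply_symm_apply x)
            rwa [hπ, hπ]
      simpa using key_le _ _ hij

theorem mem_language_of_isTrace (h : Labels v pos a) {x : Word (Event P V)}
    (hx : IsTrace a x) : x ∈ (chart pos).language := by
  cases x with
  | fin w => exact (h.exists_equiv_iff w.get).2 hx.exists_isLin_fin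
  | inf w => exact (h.exists_equiv_iff w).2 hx.exists_isLin_inf

theorem mem_closure_of_mem_language (h : Labels v pos a) {x : Word (Event P V)}
    (hx : x ∈ (chart pos).language) : x ∈ closure {y | IsTrace a y} := by
  cases x with
  | fin w =>
    obtain ⟨f, hf⟩ := (h.exists_equiv_iff w.get).1 hx
    exact hf.exists_isTrace_fin h.matched
  | inf w =>
    obtain ⟨f, hf⟩ := (h.exists_equiv_iff w).1 hx
    exact hf.exists_isTrace_inf h.matched

end Labels

/-! ### Runs of the automaton and paths of the HMSC -/

/-- The label of the transition along an edge. -/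
def edgeLabel : Position P V T → Position P V T → Option (Event P V)
  | .branch p _ q m _ j, _ => some (.recv p (q j) (m j))
  | .term _, .branch p _ q m _ j => some (.send p (q j) (m j))
  | .term _, .term _ => none

theorem trans_iff (x y : Position P V T) (a : Option (Event P V)) :
    Trans x a y ↔ Edge x y ∧ a = edgeLabel x y := by
  constructor
  · rintro (_ | _ | _ | _)
    · exact ⟨.mu _ _, rfl⟩
    · exact ⟨.var _ _, rfl⟩
    · exact ⟨.choose _ _ _ _ _ _, rfl⟩
    · exact ⟨.next _ _ _ _ _ _, rfl⟩
  · rintro ⟨_ | _ | _ | _, rfl⟩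
    · exact .mu _ _
    · exact .var _ _
    · exact .send _ _ _ _ _ _
    · exact .recv _ _ _ _ _ _

/-- An edge carries a send exactly when it enters a branch, and a reception exactly when it leaves
one. -/
theorem edgeLabel_eq_some {x y : Position P V T} (h : Edge x y) {e : Event P V}
    (he : edgeLabel x y = some e) :
    (∃ p n q m G j, y = .branch p n q m G j ∧ e = .send p (q j) (m j)) ∨
    ∃ p n q m G j, x = .branch p n q m G j ∧ e = .recv p (q j) (m j) := by
  cases h with
  | mu => cases he
  | var => cases he
  | choose => exact Or.inl ⟨_, _, _, _, _, _, rfl, (Option.some.inj he).symm⟩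
  | next => exact Or.inr ⟨_, _, _, _, _, _, rfl, (Option.some.inj he).symm⟩

theorem edgeLabel_of_branch {x : Position P V T} {p : P} {n : ℕ} {q : Fin (n + 1) → P}
    {m : Fin (n + 1) → V} {G : Fin (n + 1) → GlobalTerm P V T} {j : Fin (n + 1)}
    (h : Edge x (.branch p n q m G j)) :
    edgeLabel x (.branch p n q m G j) = some (.send p (q j) (m j)) := by
  cases h
  rfl

theorem labels_infinite {pos : ℕ → Position P V T} {G : GlobalTerm P V T}
    (h0 : pos 0 = .term G) (hpos : ∀ i, Edge (pos i) (pos (i + 1))) :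
    Labels id pos fun i => edgeLabel (pos i) (pos (i + 1)) where
  strictMono := strictMono_id
  branch := by
    intro i p n q m G' j hi
    cases i with
    | zero => rw [h0] at hi; cases hi
    | succ k =>
      refine ⟨k, rfl, ?_, ?_⟩
      · have := hpos k
        rw [hi] at this ⊢
        exact edgeLabel_of_branch this
      · simp only [hi, edgeLabel]
  letter := by
    intro k e he
    rcases edgeLabel_eq_some (hpos k) he with
      ⟨p, n, q, m, G', j, hi, rfl⟩ | ⟨p, n, q, m, G', j, hi, rfl⟩
    · exact ⟨_, _, _, _, _, _, _, hi, Or.inl ⟨rfl, rfl⟩⟩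
    · exact ⟨_, _, _, _, _, _, _, hi, Or.inr ⟨rfl, rfl⟩⟩

/-- The labels along a finite path, continued by silent moves. -/
def finLabels {N : ℕ} (pos : Fin (N + 1) → Position P V T) (k : ℕ) : Option (Event P V) :=
  if h : k < N then edgeLabel (pos (⟨k, h⟩ : Fin N).castSucc) (pos (⟨k, h⟩ : Fin N).succ) else none

theorem finLabels_of_le {N : ℕ} (pos : Fin (N + 1) → Position P V T) {k : ℕ} (h : N ≤ k) :
    finLabels pos k = none := dif_neg (not_lt.2 h)

theorem finLabels_val {N : ℕ} (pos : Fin (N + 1) → Position P V T) (i : Fin N) :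
    finLabels pos i = edgeLabel (pos i.castSucc) (pos i.succ) := dif_pos i.2

theorem reduceOption_takeInf_finLabels {N : ℕ} (pos : Fin (N + 1) → Position P V T) :
    (takeInf (finLabels pos) N).reduceOption =
      (List.ofFn fun i : Fin N => edgeLabel (pos i.castSucc) (pos i.succ)).reduceOption := by
  congr 1
  refine List.ext_getElem (by simp [takeInf]) fun i h1 h2 => ?_
  have hi : i < N := by simpa [takeInf] using h1
  simpa [takeInf] using finLabels_val pos ⟨i, hi⟩

theorem labels_finite {N : ℕ} {pos : Fin (N + 1) → Position P V T} {G : GlobalTerm P V T}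
    (h0 : pos 0 = .term G) (hpos : ∀ i : Fin N, Edge (pos i.castSucc) (pos i.succ))
    {G' : GlobalTerm P V T} (hN : pos (Fin.last N) = .term G') :
    Labels Fin.val pos (finLabels pos) where
  strictMono := Fin.val_strictMono
  branch := by
    intro i p n q m G₁ j hi
    have hi0 : i.1 ≠ 0 := by
      intro h
      obtain rfl : i = 0 := Fin.ext h
      rw [h0] at hi
      cases hi
    have hiN : i.1 ≠ N := by
      intro h
      obtain rfl : i = Fin.last N := Fin.ext h
      rw [hN] at hi
      cases hi
    obtain ⟨k, hk⟩ := Nat.exists_eq_succ_of_ne_zero hi0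
    have hlt := i.2
    refine ⟨k, hk, ?_, ?_⟩
    · have hs : (⟨k, by omega⟩ : Fin N).succ = i := Fin.ext hk.symm
      have := hpos ⟨k, by omega⟩
      rw [finLabels_val pos ⟨k, by omega⟩]
      rw [hs, hi] at this ⊢
      exact edgeLabel_of_branch this
    · have hs : (⟨k + 1, by omega⟩ : Fin N).castSucc = i := Fin.ext hk.symm
      rw [finLabels_val pos ⟨k + 1, by omega⟩, hs, hi]
      rfl
  letter := by
    intro k e he
    have hk : k < N := by
      by_contra h
      rw [finLabels_of_le pos (not_lt.1 h)] at he
      cases he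
    rw [finLabels_val pos ⟨k, hk⟩] at he
    rcases edgeLabel_eq_some (hpos ⟨k, hk⟩) he with
      ⟨p, n, q, m, G', j, hi, rfl⟩ | ⟨p, n, q, m, G', j, hi, rfl⟩
    · exact ⟨_, _, _, _, _, _, _, hi, Or.inl ⟨rfl, rfl⟩⟩
    · exact ⟨_, _, _, _, _, _, _, hi, Or.inr ⟨rfl, rfl⟩⟩

theorem language_subset (G : GlobalTerm P V T) (hG : G.IsGlobalType) :
    G.language ⊆ (G.toHMSC hG).language := by
  rintro x (⟨N, ρ, a, h0, ht, hN, rfl⟩ | ⟨ρ, a, h0, ht, hx⟩)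
  · have ht' := fun i => (trans_iff _ _ _).1 (ht i)
    obtain rfl : a = fun i => edgeLabel (ρ i.castSucc).1 (ρ i.succ).1 :=
      funext fun i => (ht' i).2
    refine Or.inl ⟨N, ρ, h0, fun i => (ht' i).1, hN, ?_⟩
    have hL := labels_finite (pos := fun i => (ρ i).1) (congrArg Subtype.val h0)
      (fun i => (ht' i).1) hN
    exact hL.mem_language_of_isTrace ⟨N, fun i hi => finLabels_of_le _ hi,
      (reduceOption_takeInf_finLabels fun i => (ρ i).1).symm⟩
  · have ht' := fun i => (trans_iff _ _ _).1 (ht i)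
    obtain rfl : a = fun i => edgeLabel (ρ i).1 (ρ (i + 1)).1 := funext fun i => (ht' i).2
    have hL := labels_infinite (pos := fun i => (ρ i).1) (congrArg Subtype.val h0)
      (fun i => (ht' i).1)
    exact Or.inr ⟨ρ, h0, fun i => (ht' i).1, hL.mem_language_of_isTrace hx⟩

theorem toHMSC_language_subset (G : GlobalTerm P V T) (hG : G.IsGlobalType) :
    (G.toHMSC hG).language ⊆ closure G.language := by
  rintro x (⟨N, ρ, h0, ht, hN, hx⟩ | ⟨ρ, h0, ht, hx⟩)
  · have hL := labels_finite (pos := fun i => (ρ i).1) (congrArg Subtype.val h0) ht hN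
    refine closure_mono ?_ (hL.mem_closure_of_mem_language hx)
    rintro (w | w) hw
    · refine Or.inl ⟨N, ρ, fun i => edgeLabel (ρ i.castSucc).1 (ρ i.succ).1, h0,
        fun i => (trans_iff _ _ _).2 ⟨ht i, rfl⟩, hN, congrArg Word.fin ?_⟩
      exact (IsTrace.fin_eq hw fun i hi => finLabels_of_le _ hi).trans
        (reduceOption_takeInf_finLabels fun i => (ρ i).1)
    · -- A finite run has no infinite trace.
      obtain ⟨φ, hφ, hφw, -⟩ := hw
      have h1 := hφw N
      rw [finLabels_of_le _ (hφ.le_apply)] at h1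
      cases h1
  · have hL := labels_infinite (pos := fun i => (ρ i).1) (congrArg Subtype.val h0) ht
    refine closure_mono ?_ (hL.mem_closure_of_mem_language hx)
    intro w hw
    exact Or.inr ⟨ρ, fun i => edgeLabel (ρ i).1 (ρ (i + 1)).1, h0,
      fun i => (trans_iff _ _ _).2 ⟨ht i, rfl⟩, hw⟩

end GlobalTerm

end MST

theorem mainTheorem2 {P V T : Type*} (G : MST.GlobalTerm P V T) (hG : G.IsGlobalType) :
    G.language ⊆ (G.toHMSC hG).language ∧
    MST.closure G.language = MST.closure (G.toHMSC hG).language :=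
  ⟨G.language_subset hG, (MST.closure_mono (G.language_subset hG)).antisymm
    (MST.closure_subset_of_subset_closure (G.toHMSC_language_subset hG))⟩
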